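/- Let $M$ and $B$ be smooth manifolds (finite-dimensional, without boundary, Hausdorff and second countable), let $\pi\colon M\to B$ be a proper smooth submersion, and let $N\subseteq M$ be a smooth embedded submanifold which is closed as a subset of $M$ and for which the restriction $\pi|_N\colon N\to B$ is also a submersion. For $b\in B$ write $M_b=\pi^{-1}(b)$ and $N_b=N\cap M_b$. Then for each $b\in B$ the fibre $M_b$ is a smooth embedded submanifold of $M$, and there are an open neighbourhood $U$ of $b$ in $B$ and a diffeomorphism $$\Psi\colon \pi^{-1}(U)\xrightarrow{\ \cong\ } M_b\times U$$ which is fibre preserving, i.e. $\mathrm{pr}_U\circ\Psi=\pi|_{\pi^{-1}(U)}$, and satisfies $$\Psi\bigl(N\cap\pi^{-1}(U)\bigr)=N_b\times U.$$ -/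

import Mathlib

open Set TopologicalSpace
open scoped Manifold ContDiff

/-- The charted space structure on the subset `S` of the smooth manifold `M` (with the subspace
topology) makes `S` a smooth embedded submanifold of `M` of dimension `k`: it is a smooth structure
for which the inclusion is a smooth embedding. There is at most one such smooth structure
on `S`. -/
structure IsEmbeddedSubmanifold {m k : ℕ} {M : Type*} [TopologicalSpace M]
    [ChartedSpace (EuclideanSpace ℝ (Fin m)) M] (S : Set M)
    [ChartedSpace (EuclideanSpace ℝ (Fin k)) S] : Prop where
  isManifold : IsManifold (𝓡 k) ∞ S
  isSmoothEmbedding : Manifold.IsSmoothEmbedding (𝓡 k) (𝓡 m) ∞ (Subtype.val : S → M)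

open Filter Topology

/-! This is Ehresmann's theorem relative to `N`, proved with a retraction instead of lifted vector
fields. Around each point of `M_b` there is a chart `(v, u)` in which `u` is `π` read in a chart of
`B` centred at `b`, and membership in `N` depends on `v` alone (`exists_isAdaptedChart`). Replacing
`u` by `(1 - χ) u`, with `χ` a bump function, moves points near the centre into the fibre, fixes the
fibre and respects `N` (`IsAdaptedChart.exists_push`). The fibre is compact because `π` is proper,
so composing finitely many such maps gives a smooth `H : M → M` that retracts a neighbourhood of
`M_b` onto `M_b` and satisfies `H y ∈ N ↔ y ∈ N` (`exists_retraction_fibre`).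

The trivialization is `y ↦ (H y, π y)`. On the fibre it is injective, and its derivative there is
invertible because `H` is the identity along `M_b` (`IsAdaptedChart.exists_local_inverse`).
Compactness spreads injectivity and the existence of preimages to a neighbourhood of the fibre, and
properness lets this neighbourhood be taken of the form `π⁻¹(U)`
(`exists_diffeomorph_of_retraction`). -/

/-- Inverse function theorem: a smooth map with invertible derivative at a point restricts to a
local homeomorphism near it whose inverse is smooth on the whole target. -/
theorem ContDiffOn.exists_openPartialHomeomorph {E F : Type*} [NormedAddCommGroup E]
    [NormedSpace ℝ E] [CompleteSpace E] [NormedAddCommGroup F] [NormedSpace ℝ F]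
    {f : E → F} {O : Set E} (hO : IsOpen O) (hf : ContDiffOn ℝ ∞ f O) {a : E} (ha : a ∈ O)
    (f' : E ≃L[ℝ] F) (hf' : HasFDerivAt f (f' : E →L[ℝ] F) a) :
    ∃ e : OpenPartialHomeomorph E F, a ∈ e.source ∧ e.source ⊆ O ∧ (∀ x, e x = f x) ∧
      ContDiffOn ℝ ∞ e.symm e.target := by
  have hfa : ContDiffAt ℝ ∞ f a := hf.contDiffAt (hO.mem_nhds ha)
  let e₀ := hfa.toOpenPartialHomeomorph f hf' (by simp)
  have hfd : ContinuousOn (fderiv ℝ f) O := hf.continuousOn_fderiv_of_isOpen hO (by simp)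
  -- Invertibility of the derivative is an open condition; restricting to it makes the inverse
  -- smooth on the whole target, not just at the image of `a`.
  let V : Set E := O ∩ fderiv ℝ f ⁻¹' range ((↑) : (E ≃L[ℝ] F) → E →L[ℝ] F)
  have hV : IsOpen V := hfd.isOpen_inter_preimage hO ContinuousLinearEquiv.isOpen
  refine ⟨e₀.restrOpen V hV, ⟨hfa.mem_toOpenPartialHomeomorph_source hf' (by simp), ha, ?_⟩,
    fun x hx ↦ hx.2.1, fun x ↦ rfl, fun y hy ↦ ?_⟩
  · exact ⟨f', hf'.fderiv.symm⟩
  · have hx := (e₀.restrOpen V hV).map_target hy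
    obtain ⟨-, hxO, f₀, hf₀⟩ := hx
    have hd := hf.contDiffAt (hO.mem_nhds hxO)
    refine ((e₀.restrOpen V hV).contDiffAt_symm hy (f₀' := f₀) ?_ hd).contDiffWithinAt
    rw [hf₀]
    exact (hd.differentiableAt (by simp)).hasFDerivAt

/-! ### Slice charts and embedded submanifolds -/

section Slice

variable {m k l : ℕ} {M : Type*} [TopologicalSpace M]

open Classical in
/-- The chart induced on `S` by a chart of the ambient space in which `S` is the slice `v = 0`. -/
noncomputable def OpenPartialHomeomorph.slice {V W : Type*} [TopologicalSpace V]
    [TopologicalSpace W] [Zero W] {S : Set M} (x : S) (q : OpenPartialHomeomorph M (V × W))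
    (hq : ∀ y ∈ q.source, y ∈ S ↔ (q y).2 = 0) : OpenPartialHomeomorph S V where
  toFun y := (q y).1
  -- Off the target the value is irrelevant; the point `x` only supplies a default.
  invFun w := if h : (w, (0 : W)) ∈ q.target then
    ⟨q.symm (w, 0), (hq _ (q.map_target h)).2 (by rw [q.right_inv h])⟩ else x
  source := Subtype.val ⁻¹' q.source
  target := (fun w ↦ (w, (0 : W))) ⁻¹' q.target
  map_source' y hy := by
    have h := (hq _ hy).1 y.2
    have h' := q.map_source hy
    rwa [← Prod.mk.eta (p := q y), h] at h'
  map_target' w hw := by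
    have hw' : (w, (0 : W)) ∈ q.target := hw
    simp [hw']
  left_inv' y hy := by
    have h := (hq _ hy).1 y.2
    have h' := q.map_source hy
    have h2 : ((q y).1, (0 : W)) = q y := by rw [← h]
    simp only [h2]
    rw [dif_pos h']
    exact Subtype.ext (q.left_inv hy)
  right_inv' w hw := by
    have hw' : (w, (0 : W)) ∈ q.target := hw
    simp [hw', q.right_inv hw']
  open_source := q.open_source.preimage continuous_subtype_val
  open_target := q.open_target.preimage (by fun_prop)
  continuousOn_toFun := by
    refine continuous_fst.comp_continuousOn ?_
    exact q.continuousOn.comp continuous_subtype_val.continuousOn (fun y hy ↦ hy)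
  continuousOn_invFun := by
    rw [continuousOn_iff_continuous_domRestrict, continuous_induced_rng]
    have : ContinuousOn (fun w : V ↦ q.symm (w, (0 : W))) ((fun w ↦ (w, (0 : W))) ⁻¹' q.target) :=
      q.continuousOn_symm.comp (by fun_prop) (fun w hw ↦ hw)
    refine (continuousOn_iff_continuous_domRestrict.1 this).congr fun w ↦ ?_
    have hw : ((w : V), (0 : W)) ∈ q.target := w.2
    simp [hw]

theorem OpenPartialHomeomorph.slice_symm_coe {V W : Type*} [TopologicalSpace V]
    [TopologicalSpace W] [Zero W] {S : Set M} (x : S) (q : OpenPartialHomeomorph M (V × W))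
    (hq : ∀ y ∈ q.source, y ∈ S ↔ (q y).2 = 0) {w : V} (hw : (w, (0 : W)) ∈ q.target) :
    ((q.slice x hq).symm w : M) = q.symm (w, 0) := by
  exact congrArg Subtype.val (dif_pos hw)

variable [ChartedSpace (EuclideanSpace ℝ (Fin m)) M]

/-- A chart of `M` with values in a product, smooth with smooth inverse. -/
structure IsSmoothProductChart
    (q : OpenPartialHomeomorph M (EuclideanSpace ℝ (Fin k) × EuclideanSpace ℝ (Fin l))) :
    Prop where
  contMDiffOn : ContMDiffOn (𝓡 m) 𝓘(ℝ, EuclideanSpace ℝ (Fin k) × EuclideanSpace ℝ (Fin l)) ∞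
    q q.source
  contMDiffOn_symm : ContMDiffOn 𝓘(ℝ, EuclideanSpace ℝ (Fin k) × EuclideanSpace ℝ (Fin l)) (𝓡 m) ∞
    q.symm q.target

/-- A subset which near each of its points is a slice of a smooth chart is an embedded
submanifold. -/
theorem exists_isEmbeddedSubmanifold_of_slice [IsManifold (𝓡 m) ∞ M]
    (T : (EuclideanSpace ℝ (Fin k) × EuclideanSpace ℝ (Fin l)) ≃L[ℝ] EuclideanSpace ℝ (Fin m))
    (S : Set M)
    (h : ∀ x ∈ S, ∃ q : OpenPartialHomeomorph M
      (EuclideanSpace ℝ (Fin k) × EuclideanSpace ℝ (Fin l)),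
      x ∈ q.source ∧ IsSmoothProductChart (m := m) q ∧ ∀ y ∈ q.source, y ∈ S ↔ (q y).2 = 0) :
    ∃ _ : ChartedSpace (EuclideanSpace ℝ (Fin k)) S,
      IsEmbeddedSubmanifold (m := m) (k := k) S := by
  choose q hxq hsm hq using h
  let c : S → OpenPartialHomeomorph S (EuclideanSpace ℝ (Fin k)) :=
    fun x ↦ (q x x.2).slice x (hq x x.2)
  let cs : ChartedSpace (EuclideanSpace ℝ (Fin k)) S :=
    { atlas := range c
      chartAt := c
      mem_chart_source := fun x ↦ hxq x x.2
      chart_mem_atlas := fun x ↦ ⟨x, rfl⟩ }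
  have hman : IsManifold (𝓡 k) ∞ S := by
    apply isManifold_of_contDiffOn
    rintro _ _ ⟨x, rfl⟩ ⟨x', rfl⟩
    simp only [modelWithCornersSelf_coe, modelWithCornersSelf_coe_symm, Function.id_comp,
      Function.comp_id, preimage_id, range_id, inter_univ]
    have key : ContDiffOn ℝ ∞ (fun w : EuclideanSpace ℝ (Fin k) ↦
        (q x' x'.2 ((q x x.2).symm (w, 0))).1) ((c x).symm ≫ₕ c x').source := by
      refine contDiff_fst.comp_contDiffOn (contMDiffOn_iff_contDiffOn.1 ?_)
      refine (hsm x' x'.2).contMDiffOn.comp ((hsm x x.2).contMDiffOn_symm.comp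
        (t := (q x x.2).target) (contMDiffOn_iff_contDiffOn.2 (by fun_prop)) ?_) ?_
      · intro w hw; exact hw.1
      · intro w hw
        have h1 : (w, (0 : EuclideanSpace ℝ (Fin l))) ∈ (q x x.2).target := hw.1
        have h2 : ((c x).symm w : M) ∈ (q x' x'.2).source := hw.2
        rwa [OpenPartialHomeomorph.slice_symm_coe _ _ _ h1] at h2
    refine key.congr fun w hw ↦ ?_
    have h1 : (w, (0 : EuclideanSpace ℝ (Fin l))) ∈ (q x x.2).target := hw.1
    change (q x' x'.2 ((c x).symm w : M)).1 = _
    rw [OpenPartialHomeomorph.slice_symm_coe _ _ _ h1]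
  refine ⟨cs, hman, ⟨⟨EuclideanSpace ℝ (Fin l), inferInstance, inferInstance, fun x ↦ ?_⟩,
    IsEmbedding.subtypeVal⟩⟩
  let φ : OpenPartialHomeomorph M (EuclideanSpace ℝ (Fin m)) :=
    (q x x.2).trans T.toHomeomorph.toOpenPartialHomeomorph
  have hsrc : φ.source = (q x x.2).source := by simp [φ]
  have htgt : φ.target = T.symm ⁻¹' (q x x.2).target := by simp [φ]
  -- In the charts `c x` and `φ` the inclusion reads `w ↦ T (w, 0)`, the normal form of an
  -- immersion.
  refine Manifold.IsImmersionAtOfComplement.mk_of_charts T (c x) φ (hxq x x.2)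
    (by rw [hsrc]; exact hxq x x.2) (IsManifold.chart_mem_maximalAtlas x) ?_ ?_ ?_
  · apply OpenPartialHomeomorph.mem_maximalAtlas_of_contMDiffOn
    · rw [hsrc]
      exact (T.contDiff.contMDiff).comp_contMDiffOn (hsm x x.2).contMDiffOn
    · rw [htgt]
      exact (hsm x x.2).contMDiffOn_symm.comp T.symm.contDiff.contMDiff.contMDiffOn
        (fun w hw ↦ hw)
  · intro y hy
    rw [mem_preimage, hsrc]
    exact hy
  · intro w hw
    have h1 : (w, (0 : EuclideanSpace ℝ (Fin l))) ∈ (q x x.2).target :=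
      show w ∈ (c x).target by simpa using hw
    change T (q x x.2 ((c x).symm w : M)) = T (w, 0)
    rw [OpenPartialHomeomorph.slice_symm_coe _ _ _ h1, (q x x.2).right_inv h1]

end Slice

/-! ### Local sections of submersions -/

/-- A submersion has a smooth local section through each point. -/
theorem Manifold.IsSubmersionAt.exists_section {m n : ℕ}
    {M : Type*} [TopologicalSpace M]
    [ChartedSpace (EuclideanSpace ℝ (Fin m)) M]
    {B : Type*} [TopologicalSpace B]
    [ChartedSpace (EuclideanSpace ℝ (Fin n)) B]
    [IsManifold (𝓡 m) ∞ M] [IsManifold (𝓡 n) ∞ B] {f : M → B} {x : M}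
    (h : Manifold.IsSubmersionAt (𝓡 m) (𝓡 n) ∞ f x) :
    ∃ σ : B → M, σ (f x) = x ∧ ContMDiffAt (𝓡 n) (𝓡 m) ∞ σ (f x) ∧
      ∀ᶠ z in 𝓝 (f x), f (σ z) = z := by
  have hw : ∀ w ∈ h.domChart.target, h.codChart (f (h.domChart.symm w)) = (h.equiv w).1 :=
    fun w hw ↦ h.writtenInCharts (by simpa using hw)
  have hxt := h.domChart.map_source h.mem_domChart_source
  -- In charts `f` is the first projection of `h.equiv`, so freezing the second component at its
  -- value at `x` gives a section.
  let j : EuclideanSpace ℝ (Fin n) → EuclideanSpace ℝ (Fin m) :=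
    fun u ↦ h.equiv.symm (u, (h.equiv (h.domChart x)).2)
  have hj : ContDiff ℝ ∞ j := h.equiv.symm.contDiff.comp (by fun_prop)
  have hjx : j (h.codChart (f x)) = h.domChart x := by
    have := hw _ hxt
    rw [h.domChart.left_inv h.mem_domChart_source] at this
    simp [j, this]
  have hcod : ContMDiffAt (𝓡 n) (𝓡 n) ∞ h.codChart (f x) :=
    contMDiffAt_of_mem_maximalAtlas h.codChart_mem_maximalAtlas h.mem_codChart_source
  have hjc : ContMDiffAt (𝓡 n) (𝓡 m) ∞ (fun z ↦ j (h.codChart z)) (f x) :=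
    hj.contMDiff.contMDiffAt.comp _ hcod
  refine ⟨fun z ↦ h.domChart.symm (j (h.codChart z)), ?_, ?_, ?_⟩
  · simp only [hjx, h.domChart.left_inv h.mem_domChart_source]
  · refine ContMDiffAt.comp (f x) (g := h.domChart.symm) ?_ hjc
    refine contMDiffAt_symm_of_mem_maximalAtlas h.domChart_mem_maximalAtlas ?_
    rwa [hjx]
  · have h1 : ∀ᶠ z in 𝓝 (f x), j (h.codChart z) ∈ h.domChart.target :=
      hjc.continuousAt.eventually (h.domChart.open_target.mem_nhds (by simpa only [hjx] using hxt))
    filter_upwards [h1, h.codChart.open_source.mem_nhds h.mem_codChart_source] with z hz hz'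
    have h2 := hw _ hz
    refine h.codChart.injOn ?_ hz' ?_
    · exact h.source_subset_preimage_source (h.domChart.map_target hz)
    · rw [h2]; simp [j]

/-! ### Charts adapted to `π` and `N` -/

section Ehresmann

variable {m n : ℕ}
  {M : Type*} [TopologicalSpace M] [ChartedSpace (EuclideanSpace ℝ (Fin m)) M]
  {B : Type*} [TopologicalSpace B] [ChartedSpace (EuclideanSpace ℝ (Fin n)) B]

/-- A smooth product chart around a point of the fibre of `π` over `b`, whose second component is
`π` read in the preferred chart at `b`, and in which `N` is a union of slices `{v} × ℝⁿ`. -/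
structure IsAdaptedChart {k : ℕ} (N : Set M) (π : M → B) (b : B)
    (q : OpenPartialHomeomorph M (EuclideanSpace ℝ (Fin k) × EuclideanSpace ℝ (Fin n))) :
    Prop extends IsSmoothProductChart (m := m) q where
  mem_source : ∀ y ∈ q.source, π y ∈ (chartAt (EuclideanSpace ℝ (Fin n)) b).source
  snd_eq : ∀ y ∈ q.source, (q y).2 =
    chartAt (EuclideanSpace ℝ (Fin n)) b (π y) - chartAt (EuclideanSpace ℝ (Fin n)) b b
  mem_iff : ∀ y ∈ q.source, ∀ y' ∈ q.source, (q y).1 = (q y').1 → (y ∈ N ↔ y' ∈ N)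

theorem IsAdaptedChart.snd_eq_zero_iff {k : ℕ} {N : Set M} {π : M → B} {b : B}
    {q : OpenPartialHomeomorph M (EuclideanSpace ℝ (Fin k) × EuclideanSpace ℝ (Fin n))}
    (hq : IsAdaptedChart (m := m) N π b q) {y : M} (hy : y ∈ q.source) :
    y ∈ π ⁻¹' {b} ↔ (q y).2 = 0 := by
  rw [hq.snd_eq y hy, sub_eq_zero]
  exact ⟨fun h ↦ by rw [show π y = b from h],
    fun h ↦ (chartAt _ b).injOn (hq.mem_source y hy) (mem_chart_source _ b) h⟩

/-- A local section of `π` along which a linear functional `L` of the coordinates is constant gives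
an adapted chart, provided membership in `N` is determined by `L`. -/
theorem exists_isAdaptedChart_of_section [IsManifold (𝓡 n) ∞ B]
    {C : Type*} [NormedAddCommGroup C] [NormedSpace ℝ C]
    {N : Set M} {π : M → B} (hπ : ContMDiff (𝓡 m) (𝓡 n) ∞ π) {x : M}
    {φ : OpenPartialHomeomorph M (EuclideanSpace ℝ (Fin m))}
    (hφ : φ ∈ IsManifold.maximalAtlas (𝓡 m) ∞ M) (hx : x ∈ φ.source)
    (L : EuclideanSpace ℝ (Fin m) →L[ℝ] C)
    (hN : ∀ y ∈ φ.source, ∀ y' ∈ φ.source, L (φ y) = L (φ y') → (y ∈ N ↔ y' ∈ N))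
    {σ : B → M} (hσx : σ (π x) = x) (hσ : ContMDiffAt (𝓡 n) (𝓡 m) ∞ σ (π x))
    (hπσ : ∀ᶠ z in 𝓝 (π x), π (σ z) = z) (hLσ : ∀ᶠ z in 𝓝 (π x), L (φ (σ z)) = L (φ x)) :
    ∃ q : OpenPartialHomeomorph M (EuclideanSpace ℝ (Fin (m - n)) × EuclideanSpace ℝ (Fin n)),
      x ∈ q.source ∧ IsAdaptedChart (m := m) N π (π x) q ∧
      Nonempty ((EuclideanSpace ℝ (Fin (m - n)) × EuclideanSpace ℝ (Fin n)) ≃L[ℝ]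
        EuclideanSpace ℝ (Fin m)) := by
  set b := π x with hb
  set ψ := chartAt (EuclideanSpace ℝ (Fin n)) b with hψ
  have hbψ : b ∈ ψ.source := mem_chart_source _ b
  have hψs : ContMDiffOn (𝓡 n) (𝓡 n) ∞ ψ ψ.source := contMDiffOn_chart
  have hψt : ContMDiffOn (𝓡 n) (𝓡 n) ∞ ψ.symm ψ.target := contMDiffOn_chart_symm
  have hφs := contMDiffOn_of_mem_maximalAtlas hφ
  have hφt := contMDiffOn_symm_of_mem_maximalAtlas hφ
  set a := φ x with ha
  let O : Set (EuclideanSpace ℝ (Fin m)) := φ.target ∩ φ.symm ⁻¹' (π ⁻¹' ψ.source)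
  have hO : IsOpen O := φ.continuousOn_symm.isOpen_inter_preimage φ.open_target
    (ψ.open_source.preimage hπ.continuous)
  have haO : a ∈ O := ⟨φ.map_source hx, by
    rw [mem_preimage, mem_preimage, ha, φ.left_inv hx]; exact hbψ⟩
  let g : EuclideanSpace ℝ (Fin m) → EuclideanSpace ℝ (Fin n) := fun w ↦ ψ (π (φ.symm w))
  have hg : ContDiffOn ℝ ∞ g O := contMDiffOn_iff_contDiffOn.1 <|
    hψs.comp (hπ.comp_contMDiffOn (hφt.mono inter_subset_left)) (fun w hw ↦ hw.2)
  let τ : EuclideanSpace ℝ (Fin n) → EuclideanSpace ℝ (Fin m) := fun u ↦ φ (σ (ψ.symm u))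
  have hψb : ψ.symm (ψ b) = b := ψ.left_inv hbψ
  have hψat : ContMDiffAt (𝓡 n) (𝓡 n) ∞ ψ.symm (ψ b) :=
    hψt.contMDiffAt (ψ.open_target.mem_nhds (ψ.map_source hbψ))
  have hσψ : ContMDiffAt (𝓡 n) (𝓡 m) ∞ (fun u ↦ σ (ψ.symm u)) (ψ b) :=
    ContMDiffAt.comp (ψ b) (by rwa [hψb]) hψat
  have hτa : τ (ψ b) = a := by simp only [τ, hψb, hσx, ha]
  have hτ : ContDiffAt ℝ ∞ τ (ψ b) := contMDiffAt_iff_contDiffAt.1 <|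
    ContMDiffAt.comp (ψ b) (hφs.contMDiffAt (φ.open_source.mem_nhds (by
      simp only [hψb, hσx]; exact hx))) hσψ
  have hψcont : Tendsto ψ.symm (𝓝 (ψ b)) (𝓝 b) := by
    simpa [hψb] using hψat.continuousAt.tendsto
  have hgτ : (fun u ↦ g (τ u)) =ᶠ[𝓝 (ψ b)] fun u ↦ u := by
    have h1 : ∀ᶠ u in 𝓝 (ψ b), σ (ψ.symm u) ∈ φ.source :=
      hσψ.continuousAt.eventually (φ.open_source.mem_nhds (by simp only [hψb, hσx]; exact hx))
    filter_upwards [h1, hψcont.eventually hπσ, ψ.open_target.mem_nhds (ψ.map_source hbψ)]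
      with u hu hu' hu''
    simp only [g, τ, φ.left_inv hu, hu', ψ.right_inv hu'']
  have hLτ : (fun u ↦ L (τ u)) =ᶠ[𝓝 (ψ b)] fun _ ↦ L a := hψcont.eventually hLσ
  have hgd : HasFDerivAt g (fderiv ℝ g a) a :=
    ((hg.contDiffAt (hO.mem_nhds haO)).differentiableAt (by simp)).hasFDerivAt
  have hτd : HasFDerivAt τ (fderiv ℝ τ (ψ b)) (ψ b) :=
    (hτ.differentiableAt (by simp)).hasFDerivAt
  set D := fderiv ℝ g a
  set s := fderiv ℝ τ (ψ b)
  have hDs' : D.comp s = ContinuousLinearMap.id ℝ _ := by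
    have h1 : HasFDerivAt (fun u ↦ g (τ u)) (D.comp s) (ψ b) :=
      HasFDerivAt.comp (g := g) (ψ b) (by rwa [hτa]) hτd
    exact h1.unique ((hasFDerivAt_id _).congr_of_eventuallyEq hgτ)
  have hLs' : L.comp s = 0 := by
    have h1 : HasFDerivAt (fun u ↦ L (τ u)) (L.comp s) (ψ b) := L.hasFDerivAt.comp (ψ b) hτd
    exact h1.unique ((hasFDerivAt_const _ _).congr_of_eventuallyEq hLτ)
  have hDs : Function.RightInverse s D := fun u ↦ by
    simpa using congrArg (fun A ↦ A u) hDs'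
  have hLs : ∀ u, L (s u) = 0 := fun u ↦ by simpa using congrArg (fun A ↦ A u) hLs'
  -- The source splits as `ker D ⊕ im s`, and `e₁ w = (D w, w - s (D w))`.
  let e₁ := ContinuousLinearEquiv.equivOfRightInverse D s hDs
  -- The truncated subtraction is harmless: `e₁` forces `m = n + dim ker D`.
  have hdim : Module.finrank ℝ D.ker = Module.finrank ℝ (EuclideanSpace ℝ (Fin (m - n))) := by
    have h1 := e₁.toLinearEquiv.finrank_eq
    rw [Module.finrank_prod] at h1
    simp only [finrank_euclideanSpace_fin] at h1 ⊢
    omega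
  let e₂ : D.ker ≃L[ℝ] EuclideanSpace ℝ (Fin (m - n)) := ContinuousLinearEquiv.ofFinrankEq hdim
  let T := (e₁.trans (ContinuousLinearEquiv.prodComm ℝ _ _)).trans
    (e₂.prodCongr (ContinuousLinearEquiv.refl ℝ (EuclideanSpace ℝ (Fin n))))
  have hT1 : ∀ w, (T w).1 = e₂ (e₁ w).2 := fun w ↦ rfl
  have hT2 : ∀ w, (T w).2 = D w := fun w ↦ rfl
  -- The first component stays linear, the projection to `ker D` along `im s`; the second is `π`
  -- itself. The derivative at `a` is `T`.
  let F : EuclideanSpace ℝ (Fin m) → EuclideanSpace ℝ (Fin (m - n)) × EuclideanSpace ℝ (Fin n) :=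
    fun w ↦ ((T w).1, g w - ψ b)
  have hF : ContDiffOn ℝ ∞ F O :=
    ((contDiff_fst.comp T.contDiff).contDiffOn).prodMk (hg.sub contDiffOn_const)
  have hFd : HasFDerivAt F (T : EuclideanSpace ℝ (Fin m) →L[ℝ] _) a := by
    have h1 : HasFDerivAt (fun w ↦ (T w).1) ((ContinuousLinearMap.fst ℝ _ _).comp
      (T : EuclideanSpace ℝ (Fin m) →L[ℝ]
        EuclideanSpace ℝ (Fin (m - n)) × EuclideanSpace ℝ (Fin n))) a := T.hasFDerivAt.fst
    exact h1.prodMk (hgd.sub_const (ψ b))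
  obtain ⟨e, hae, heO, heF, hes⟩ := hF.exists_openPartialHomeomorph hO haO T hFd
  have hqs : ∀ y ∈ (φ.trans e).source, y ∈ φ.source ∧ φ y ∈ e.source := fun y hy ↦ by
    simpa using hy
  have hq : ∀ y, (φ.trans e) y = F (φ y) := fun y ↦ heF _
  refine ⟨φ.trans e, by simpa using ⟨hx, hae⟩, ⟨⟨?_, ?_⟩, ?_, ?_, ?_⟩, ⟨T.symm⟩⟩
  · refine ContMDiffOn.congr (f := fun y ↦ F (φ y)) ?_ (fun y _ ↦ hq y)
    exact hF.contMDiffOn.comp (hφs.mono fun y hy ↦ (hqs y hy).1) fun y hy ↦ heO (hqs y hy).2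
  · refine hφt.comp (hes.contMDiffOn.mono fun w hw ↦ ?_) fun w hw ↦ ?_
    · exact (by simpa using hw : w ∈ e.target ∧ _).1
    · exact (by simpa using hw : _ ∧ e.symm w ∈ φ.target).2
  · intro y hy
    have := (heO (hqs y hy).2).2
    rwa [mem_preimage, φ.left_inv (hqs y hy).1] at this
  · intro y hy
    rw [hq]
    simp only [F, g, φ.left_inv (hqs y hy).1, hψ]
  · intro y hy y' hy' h
    rw [hq, hq] at h
    have h1 : (e₁ (φ y)).2 = (e₁ (φ y')).2 := e₂.injective h
    -- The coordinates of `y` and `y'` differ by an element of `im s`, which `L` kills.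
    have h2 : φ y - s (D (φ y)) = φ y' - s (D (φ y')) := congrArg Subtype.val h1
    refine hN y (hqs y hy).1 y' (hqs y' hy').1 ?_
    simpa [hLs] using congrArg L h2

/-- Near a point of an embedded submanifold, the submanifold is the zero set of a linear map read
in a chart. -/
theorem IsEmbeddedSubmanifold.exists_chart {p : ℕ} {N : Set M}
    [ChartedSpace (EuclideanSpace ℝ (Fin p)) N]
    (hN : IsEmbeddedSubmanifold (m := m) (k := p) N) (x : N) :
    ∃ φ ∈ IsManifold.maximalAtlas (𝓡 m) ∞ M, (x : M) ∈ φ.source ∧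
      ∃ L : EuclideanSpace ℝ (Fin m) →L[ℝ] EuclideanSpace ℝ (Fin m),
        ∀ y ∈ φ.source, y ∈ N ↔ L (φ y) = 0 := by
  obtain ⟨F, _, _, hF⟩ := hN.isSmoothEmbedding.isImmersion
  have h := hF x
  have hw : ∀ w ∈ h.domChart.target, h.codChart (h.domChart.symm w : N) = h.equiv (w, 0) :=
    fun w hw ↦ h.writtenInCharts (by simpa using hw)
  obtain ⟨O, hO, hOd⟩ := isOpen_induced_iff.1 h.domChart.open_source
  let P : EuclideanSpace ℝ (Fin m) → EuclideanSpace ℝ (Fin p) := fun w ↦ (h.equiv.symm w).1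
  have hP : Continuous P := by fun_prop
  have hw' : ∀ y : N, y ∈ h.domChart.source → h.codChart y = h.equiv (h.domChart y, 0) := by
    intro y hy
    have := hw _ (h.domChart.map_source hy)
    rwa [h.domChart.left_inv hy] at this
  have hV : IsOpen (h.codChart.source ∩ h.codChart ⁻¹' (P ⁻¹' h.domChart.target)) :=
    h.codChart.isOpen_inter_preimage (h.domChart.open_target.preimage hP)
  -- The condition on `P` makes `(P w, 0)` the image of an actual point of `N`; the condition `O`,
  -- available because `N` carries the subspace topology, excludes other sheets of `N`.
  let V := (h.codChart.source ∩ h.codChart ⁻¹' (P ⁻¹' h.domChart.target)) ∩ O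
  -- This is the projection to the complement `F`, carried back into `ℝᵐ` so that `F` does not
  -- appear in the conclusion.
  let L : EuclideanSpace ℝ (Fin m) →L[ℝ] EuclideanSpace ℝ (Fin m) :=
    (h.equiv : _ →L[ℝ] EuclideanSpace ℝ (Fin m)).comp
      (((ContinuousLinearMap.inr ℝ (EuclideanSpace ℝ (Fin p)) F).comp
      (ContinuousLinearMap.snd ℝ (EuclideanSpace ℝ (Fin p)) F)).comp
      (h.equiv.symm : EuclideanSpace ℝ (Fin m) →L[ℝ] _))
  have hL : ∀ w, L w = 0 ↔ (h.equiv.symm w).2 = 0 := fun w ↦ by simp [L]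
  have hxO : (x : M) ∈ O := by
    have : x ∈ Subtype.val ⁻¹' O := by rw [hOd]; exact h.mem_domChart_source
    exact this
  have hVo : IsOpen V := hV.inter hO
  refine ⟨h.codChart.restr V,
    restr_mem_maximalAtlas (contDiffGroupoid ∞ (𝓡 m)) h.codChart_mem_maximalAtlas hVo, ?_, L, ?_⟩
  · rw [OpenPartialHomeomorph.restr_source' _ _ hVo]
    refine ⟨h.mem_codChart_source, ⟨h.mem_codChart_source, ?_⟩, hxO⟩
    change P (h.codChart x) ∈ h.domChart.target
    rw [hw' x h.mem_domChart_source]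
    simpa [P] using h.domChart.map_source h.mem_domChart_source
  · rw [OpenPartialHomeomorph.restr_source' _ _ hVo]
    rintro y ⟨hy, ⟨-, hyP⟩, hyO⟩
    change y ∈ N ↔ L (h.codChart y) = 0
    rw [hL]
    constructor
    · intro hyN
      have hyd : (⟨y, hyN⟩ : N) ∈ h.domChart.source := by rw [← hOd]; exact hyO
      rw [hw' ⟨y, hyN⟩ hyd]
      simp
    · intro h0
      have h1 := hw _ hyP
      have h2 : h.equiv (P (h.codChart y), 0) = h.codChart y := by
        rw [← h0]; simp [P]
      rw [h2] at h1
      have h3 := h.source_subset_preimage_source (h.domChart.map_target hyP)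
      rw [← h.codChart.injOn h3 hy h1]
      exact Subtype.coe_prop _

/-- At a point of `N`, a section of `π|_N` stays in `N`, where the linear equation `L` of `N`
vanishes identically. Off `N`, closedness gives a chart missing `N`, and any section of `π` works
with `L = 0`. -/
theorem exists_isAdaptedChart [IsManifold (𝓡 m) ∞ M] [IsManifold (𝓡 n) ∞ B]
    {p : ℕ} {N : Set M} [ChartedSpace (EuclideanSpace ℝ (Fin p)) N]
    (hN : IsEmbeddedSubmanifold (m := m) (k := p) N) (hN_closed : IsClosed N)
    {π : M → B} (hπ : Manifold.IsSubmersion (𝓡 m) (𝓡 n) ∞ π)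
    (hπN : Manifold.IsSubmersion (𝓡 p) (𝓡 n) ∞ (fun x : N => π x)) (x : M) :
    ∃ q : OpenPartialHomeomorph M (EuclideanSpace ℝ (Fin (m - n)) × EuclideanSpace ℝ (Fin n)),
      x ∈ q.source ∧ IsAdaptedChart (m := m) N π (π x) q ∧
      Nonempty ((EuclideanSpace ℝ (Fin (m - n)) × EuclideanSpace ℝ (Fin n)) ≃L[ℝ]
        EuclideanSpace ℝ (Fin m)) := by
  by_cases hx : x ∈ N
  · have := hN.isManifold
    obtain ⟨φ, hφ, hxφ, L, hL⟩ := hN.exists_chart ⟨x, hx⟩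
    obtain ⟨σ, hσx, hσ, hσπ⟩ := (hπN.isSubmersionAt ⟨x, hx⟩).exists_section
    have hσ' : ContMDiffAt (𝓡 n) (𝓡 m) ∞ (fun z ↦ (σ z : M)) (π x) :=
      hN.isSmoothEmbedding.contMDiff.contMDiffAt.comp _ hσ
    have hσx' : (σ (π x) : M) = x := congrArg Subtype.val hσx
    refine exists_isAdaptedChart_of_section hπ.contMDiff hφ hxφ L (fun y hy y' hy' h ↦ ?_)
      hσx' hσ' hσπ ?_
    · rw [hL y hy, hL y' hy', h]
    · have h1 : ∀ᶠ z in 𝓝 (π x), (σ z : M) ∈ φ.source :=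
        hσ'.continuousAt.eventually (φ.open_source.mem_nhds (by simpa only [hσx'] using hxφ))
      filter_upwards [h1] with z hz
      rw [(hL _ hz).1 (σ z).2, (hL _ hxφ).1 hx]
  · obtain ⟨σ, hσx, hσ, hσπ⟩ := (hπ.isSubmersionAt x).exists_section
    refine exists_isAdaptedChart_of_section hπ.contMDiff
      (restr_mem_maximalAtlas (contDiffGroupoid ∞ (𝓡 m))
        (IsManifold.chart_mem_maximalAtlas (I := 𝓡 m) (n := ∞) x) hN_closed.isOpen_compl)
      (x := x) ?_ (0 : _ →L[ℝ] ℝ) ?_ hσx hσ hσπ (by simp)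
    · rw [OpenPartialHomeomorph.restr_source' _ _ hN_closed.isOpen_compl]
      exact ⟨mem_chart_source _ x, hx⟩
    · rw [OpenPartialHomeomorph.restr_source' _ _ hN_closed.isOpen_compl]
      exact fun y hy y' hy' _ ↦ iff_of_false hy.2 hy'.2

/-! ### Retraction of a neighbourhood onto the fibre -/

open Classical in
/-- Shrinking the base coordinate of an adapted chart by a bump function gives a smooth self-map
of `M` which fixes the fibre, preserves `N` and its complement, and maps a neighbourhood of a given
point of the fibre into the fibre. -/
theorem IsAdaptedChart.exists_push [IsManifold (𝓡 m) ∞ M] [T2Space M] {k : ℕ} {N : Set M} {π : M → B} {b : B}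
    {q : OpenPartialHomeomorph M (EuclideanSpace ℝ (Fin k) × EuclideanSpace ℝ (Fin n))}
    (hq : IsAdaptedChart (m := m) N π b q) {x : M} (hx : x ∈ q.source) (hxb : π x = b) :
    ∃ H : M → M, ContMDiff (𝓡 m) (𝓡 m) ∞ H ∧ (∀ y ∈ π ⁻¹' {b}, H y = y) ∧
      (∀ y, H y ∈ N ↔ y ∈ N) ∧ ∀ᶠ y in 𝓝 x, H y ∈ π ⁻¹' {b} := by
  obtain ⟨r, hr, hball⟩ := Metric.isOpen_iff.1 q.open_target _ (q.map_source hx)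
  have hx0 : (q x).2 = 0 := (hq.snd_eq_zero_iff hx).1 hxb
  let W : Set M := q.source ∩ q ⁻¹' Metric.ball (q x) r
  have hW : IsOpen W := q.isOpen_inter_preimage Metric.isOpen_ball
  have hxW : W ∈ 𝓝 x := hW.mem_nhds ⟨hx, Metric.mem_ball_self hr⟩
  obtain ⟨χ, -, hχ⟩ := (SmoothBumpFunction.nhds_basis_tsupport (I := 𝓡 m) x).mem_iff.1 hxW
  let J : M → EuclideanSpace ℝ (Fin k) × EuclideanSpace ℝ (Fin n) :=
    fun y ↦ ((q y).1, (1 - χ y) • (q y).2)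
  -- The ball is taken in the sup metric and its centre has second component `0`, so scaling that
  -- component by a factor in `[0, 1]` does not leave it.
  have hJ : ∀ y ∈ W, J y ∈ q.target := by
    rintro y ⟨-, hy⟩
    apply hball
    rw [mem_preimage, Metric.mem_ball, Prod.dist_eq, max_lt_iff] at hy
    rw [Metric.mem_ball, Prod.dist_eq, max_lt_iff]
    refine ⟨hy.1, lt_of_le_of_lt ?_ hy.2⟩
    rw [hx0, dist_zero_right, dist_zero_right, norm_smul]
    refine mul_le_of_le_one_left (norm_nonneg _) ?_
    rw [Real.norm_eq_abs, abs_le]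
    constructor <;> linarith [χ.nonneg (x := y), χ.le_one (x := y)]
  let H : M → M := fun y ↦ if y ∈ W then q.symm (J y) else y
  have hHW : ∀ y ∈ W, H y = q.symm (J y) := fun y hy ↦ if_pos hy
  have hHid : ∀ y, (y ∈ W → J y = q y) → H y = y := by
    intro y hy
    by_cases hyW : y ∈ W
    · rw [hHW y hyW, hy hyW, q.left_inv hyW.1]
    · exact if_neg hyW
  refine ⟨H, fun y ↦ ?_, fun y hy ↦ ?_, fun y ↦ ?_, ?_⟩
  · by_cases hyW : y ∈ W
    · refine ContMDiffAt.congr_of_eventuallyEq (f := fun y ↦ q.symm (J y)) ?_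
        (eventually_of_mem (hW.mem_nhds hyW) hHW)
      have hqy := hq.contMDiffOn.contMDiffAt (q.open_source.mem_nhds hyW.1)
      have h1 : ContMDiffAt (𝓡 m) (𝓡 k) ∞ (fun y ↦ (q y).1) y :=
        contDiff_fst.contMDiff.contMDiffAt.comp y hqy
      have h2 : ContMDiffAt (𝓡 m) (𝓡 n) ∞ (fun y ↦ (q y).2) y :=
        contDiff_snd.contMDiff.contMDiffAt.comp y hqy
      have h3 : ContMDiffAt (𝓡 m) (𝓡 n) ∞ (fun y ↦ (1 - χ y) • (q y).2) y :=
        (contMDiffAt_const.sub χ.contMDiffAt).smul h2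
      exact ContMDiffAt.comp y
        (hq.contMDiffOn_symm.contMDiffAt (q.open_target.mem_nhds (hJ y hyW)))
        (h1.prodMk_space h3)
    -- Outside the closed set `tsupport χ ⊆ W` both branches of `H` are the identity, so they glue
    -- smoothly.
    · have hys : y ∉ tsupport χ := fun h ↦ hyW (hχ h)
      refine contMDiffAt_id.congr_of_eventuallyEq
        (eventually_of_mem ((isClosed_tsupport χ).isOpen_compl.mem_nhds hys) fun z hz ↦ ?_)
      refine hHid z fun _ ↦ ?_
      simp [J, image_eq_zero_of_notMem_tsupport hz]
  · refine hHid y fun hyW ↦ ?_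
    have := (hq.snd_eq_zero_iff hyW.1).1 hy
    exact Prod.ext rfl (by simp [J, this])
  · by_cases hyW : y ∈ W
    · rw [hHW y hyW]
      refine hq.mem_iff _ (q.map_target (hJ y hyW)) _ hyW.1 ?_
      rw [q.right_inv (hJ y hyW)]
    · rw [show H y = y from if_neg hyW]
  · filter_upwards [hxW, χ.eventuallyEq_one] with y hyW hy
    rw [hHW y hyW, hq.snd_eq_zero_iff (q.map_target (hJ y hyW)), q.right_inv (hJ y hyW)]
    simp [J, hy]

/-- A smooth self-map of `M` retracting a neighbourhood of a compact fibre onto the fibre,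
compatibly with `N`. -/
theorem exists_retraction_fibre [IsManifold (𝓡 m) ∞ M] [T2Space M] {k : ℕ} {N : Set M} {π : M → B} {b : B}
    (hc : IsCompact (π ⁻¹' {b}))
    (h : ∀ x ∈ π ⁻¹' {b}, ∃ q : OpenPartialHomeomorph M
      (EuclideanSpace ℝ (Fin k) × EuclideanSpace ℝ (Fin n)),
      x ∈ q.source ∧ IsAdaptedChart (m := m) N π b q) :
    ∃ H : M → M, ContMDiff (𝓡 m) (𝓡 m) ∞ H ∧ (∀ y ∈ π ⁻¹' {b}, H y = y) ∧
      (∀ y, H y ∈ N ↔ y ∈ N) ∧ ∀ x ∈ π ⁻¹' {b}, ∀ᶠ y in 𝓝 x, H y ∈ π ⁻¹' {b} := by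
  -- The repeated membership separates the induction set from the fibre: the induction varies the
  -- first occurrence only.
  suffices ∃ H : M → M, ContMDiff (𝓡 m) (𝓡 m) ∞ H ∧ (∀ y ∈ π ⁻¹' {b}, H y = y) ∧
      (∀ y, H y ∈ N ↔ y ∈ N) ∧
      ∀ x ∈ π ⁻¹' {b}, x ∈ π ⁻¹' {b} → ∀ᶠ y in 𝓝 x, H y ∈ π ⁻¹' {b} by
    obtain ⟨H, h1, h2, h3, h4⟩ := this
    exact ⟨H, h1, h2, h3, fun x hx ↦ h4 x hx hx⟩
  refine hc.induction_on (p := fun s ↦ ∃ H : M → M, ContMDiff (𝓡 m) (𝓡 m) ∞ H ∧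
      (∀ y ∈ π ⁻¹' {b}, H y = y) ∧ (∀ y, H y ∈ N ↔ y ∈ N) ∧
      ∀ x ∈ s, x ∈ π ⁻¹' {b} → ∀ᶠ y in 𝓝 x, H y ∈ π ⁻¹' {b}) ?_ ?_ ?_ ?_
  · exact ⟨id, contMDiff_id, by simp, by simp, by simp⟩
  · rintro s t hst ⟨H, h1, h2, h3, h4⟩
    exact ⟨H, h1, h2, h3, fun x hx ↦ h4 x (hst hx)⟩
  · rintro s t ⟨H, h1, h2, h3, h4⟩ ⟨G, g1, g2, g3, g4⟩
    -- Near points of `s`, `H` already lands in the fibre, which `G` fixes; near points of `t` in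
    -- the fibre, `H` stays close to the point by continuity and `G` does the rest.
    refine ⟨G ∘ H, g1.comp h1, fun y hy ↦ ?_, fun y ↦ ?_, ?_⟩
    · rw [Function.comp_apply, h2 y hy, g2 y hy]
    · rw [Function.comp_apply, g3, h3]
    · rintro x (hx | hx) hxb
      · filter_upwards [h4 x hx hxb] with y hy
        rwa [Function.comp_apply, g2 _ hy]
      · have : Tendsto H (𝓝 x) (𝓝 x) := by
          simpa [h2 x hxb] using h1.continuous.tendsto x
        exact this.eventually (g4 x hx hxb)
  · intro x hx
    obtain ⟨q, hxq, hq⟩ := h x hx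
    obtain ⟨H, h1, h2, h3, h4⟩ := hq.exists_push hxq hx
    exact ⟨{y | ∀ᶠ z in 𝓝 y, H z ∈ π ⁻¹' {b}}, mem_nhdsWithin_of_mem_nhds h4.eventually_nhds,
      H, h1, h2, h3, fun y hy _ ↦ hy⟩

/-! ### Local inverses along the fibre -/

/-- A map `y ↦ (ρ y, π y)`, where `ρ` is a smooth retraction onto the fibre, has a smooth local
inverse at each point of the fibre. -/
theorem IsAdaptedChart.exists_local_inverse [IsManifold (𝓡 n) ∞ B] {k : ℕ} {N : Set M} {π : M → B} {b : B}
    [ChartedSpace (EuclideanSpace ℝ (Fin k)) (π ⁻¹' {b})]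
    (hS : ContMDiff (𝓡 k) (𝓡 m) ∞ (Subtype.val : π ⁻¹' {b} → M))
    {q : OpenPartialHomeomorph M (EuclideanSpace ℝ (Fin k) × EuclideanSpace ℝ (Fin n))}
    (hq : IsAdaptedChart (m := m) N π b q) {x : π ⁻¹' {b}} (hx : (x : M) ∈ q.source)
    {H : M → M} (hH : ContMDiff (𝓡 m) (𝓡 m) ∞ H) (hHid : ∀ y ∈ π ⁻¹' {b}, H y = y)
    (hHS : ∀ᶠ y in 𝓝 (x : M), H y ∈ π ⁻¹' {b}) :
    ∃ g : (π ⁻¹' {b} : Set M) × B → M, g (x, b) = x ∧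
      (∀ᶠ z in 𝓝 (x, b), ContMDiffAt ((𝓡 k).prod (𝓡 n)) (𝓡 m) ∞ g z ∧
        H (g z) = z.1 ∧ π (g z) = z.2) ∧
      ∀ᶠ y in 𝓝 (x : M), ∀ hy : H y ∈ π ⁻¹' {b}, g (⟨H y, hy⟩, π y) = y := by
  set ψ := chartAt (EuclideanSpace ℝ (Fin n)) b with hψ
  have hbψ : b ∈ ψ.source := mem_chart_source _ b
  have hψs : ContMDiffOn (𝓡 n) (𝓡 n) ∞ ψ ψ.source := contMDiffOn_chart
  have hHx : H x = x := hHid x x.2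
  have hqx0 : (q x).2 = 0 := (hq.snd_eq_zero_iff hx).1 x.2
  let O := q.target ∩ q.symm ⁻¹' (H ⁻¹' q.source)
  have hO : IsOpen O := q.isOpen_inter_preimage_symm (q.open_source.preimage hH.continuous)
  have hxO : q x ∈ O := ⟨q.map_source hx, by
    rw [mem_preimage, mem_preimage, q.left_inv hx, hHx]; exact hx⟩
  let c : EuclideanSpace ℝ (Fin k) × EuclideanSpace ℝ (Fin n) → EuclideanSpace ℝ (Fin k) :=
    fun w ↦ (q (H (q.symm w))).1
  have hc : ContDiffOn ℝ ∞ c O := contDiff_fst.comp_contDiffOn <| contMDiffOn_iff_contDiffOn.1 <|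
    hq.contMDiffOn.comp (hH.comp_contMDiffOn (hq.contMDiffOn_symm.mono inter_subset_left))
      fun w hw ↦ hw.2
  let Θ : EuclideanSpace ℝ (Fin k) × EuclideanSpace ℝ (Fin n) →
      EuclideanSpace ℝ (Fin k) × EuclideanSpace ℝ (Fin n) := fun w ↦ (c w, w.2)
  have hΘ : ContDiffOn ℝ ∞ Θ O := hc.prodMk contDiff_snd.contDiffOn
  have hcd : HasFDerivAt c (fderiv ℝ c (q x)) (q x) :=
    ((hc.contDiffAt (hO.mem_nhds hxO)).differentiableAt (by simp)).hasFDerivAt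
  set A := fderiv ℝ c (q x)
  -- `H` is the identity on the fibre `u = 0`, so `c (v, 0) = v`.
  have hA : ∀ v, A (v, 0) = v := by
    let i : EuclideanSpace ℝ (Fin k) → EuclideanSpace ℝ (Fin k) × EuclideanSpace ℝ (Fin n) :=
      fun v ↦ (v, 0)
    have hi : HasFDerivAt i (ContinuousLinearMap.inl ℝ _ _) (q x).1 :=
      (ContinuousLinearMap.inl ℝ (EuclideanSpace ℝ (Fin k))
        (EuclideanSpace ℝ (Fin n))).hasFDerivAt
    have hix : i (q x).1 = q x := Prod.ext rfl hqx0.symm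
    have h1 : HasFDerivAt (fun v ↦ c (i v)) (A.comp (ContinuousLinearMap.inl ℝ _ _)) (q x).1 :=
      HasFDerivAt.comp (g := c) (q x).1 (by rwa [hix]) hi
    have h2 : (fun v ↦ c (i v)) =ᶠ[𝓝 (q x).1] fun v ↦ v := by
      have : ∀ᶠ v in 𝓝 (q x).1, i v ∈ q.target :=
        hi.continuousAt.eventually (q.open_target.mem_nhds (by rw [hix]; exact q.map_source hx))
      filter_upwards [this] with v hv
      have : q.symm (i v) ∈ π ⁻¹' {b} := by
        rw [hq.snd_eq_zero_iff (q.map_target hv), q.right_inv hv]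
      simp only [c, hHid _ this, q.right_inv hv, i]
    have h3 := h1.unique ((hasFDerivAt_id _).congr_of_eventuallyEq h2)
    intro v
    simpa using congrArg (fun L ↦ L v) h3
  -- The derivative of `Θ` is block unitriangular, hence explicitly invertible.
  let T : (EuclideanSpace ℝ (Fin k) × EuclideanSpace ℝ (Fin n)) ≃L[ℝ]
      (EuclideanSpace ℝ (Fin k) × EuclideanSpace ℝ (Fin n)) :=
    ContinuousLinearEquiv.equivOfInverse (A.prod (ContinuousLinearMap.snd ℝ _ _))
      ((ContinuousLinearMap.fst ℝ _ _ - A.comp ((ContinuousLinearMap.inr ℝ _ _).comp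
        (ContinuousLinearMap.snd ℝ _ _))).prod (ContinuousLinearMap.snd ℝ _ _))
      (fun w ↦ by
        have : A w = A (w.1, 0) + A (0, w.2) := by rw [← map_add]; simp
        refine Prod.ext ?_ rfl
        simp [this, hA])
      (fun w ↦ by
        have : A (w.1 - A (0, w.2), w.2) = A (w.1 - A (0, w.2), 0) + A (0, w.2) := by
          rw [← map_add]; simp
        refine Prod.ext ?_ rfl
        simp [this, hA])
  have hΘd : HasFDerivAt Θ (T : _ →L[ℝ] _) (q x) := hcd.prodMk hasFDerivAt_snd
  obtain ⟨e, hxe, heO, heΘ, hes⟩ := hΘ.exists_openPartialHomeomorph hO hxO T hΘd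
  have hΘq : ∀ y ∈ q.source, H y ∈ q.source → ∀ hy : H y ∈ π ⁻¹' {b},
      Θ (q y) = ((q (H y)).1, ψ (π y) - ψ b) := fun y hy hy' hyb ↦ by
    simp only [Θ, c, q.left_inv hy, hq.snd_eq y hy, hψ]
  have hexx : e (q x) = ((q x).1, ψ b - ψ b) := by
    rw [heΘ, hΘq x hx (by rwa [hHx]) (by rw [hHx]; exact x.2), hHx, show π x = b from x.2]
  -- These are the coordinates of a point of `M_b × B`; at `(H y, π y)` they equal `Θ (q y)` for `y`
  -- near `x`, so `g` undoes `y ↦ (H y, π y)`.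
  let t : (π ⁻¹' {b} : Set M) × B → EuclideanSpace ℝ (Fin k) × EuclideanSpace ℝ (Fin n) :=
    fun z ↦ ((q z.1).1, ψ z.2 - ψ b)
  have htx : t (x, b) = e (q x) := hexx.symm
  have ht : ∀ z : (π ⁻¹' {b} : Set M) × B, (z.1 : M) ∈ q.source → z.2 ∈ ψ.source →
      ContMDiffAt ((𝓡 k).prod (𝓡 n)) 𝓘(ℝ, EuclideanSpace ℝ (Fin k) × EuclideanSpace ℝ (Fin n))
        ∞ t z := by
    intro z hz1 hz2
    have h1 : ContMDiffAt ((𝓡 k).prod (𝓡 n)) (𝓡 m) ∞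
      (fun z : (π ⁻¹' {b} : Set M) × B ↦ (z.1 : M)) z := (hS.comp contMDiff_fst).contMDiffAt
    have h2 : ContMDiffAt ((𝓡 k).prod (𝓡 n)) (𝓡 k) ∞
        (fun z : (π ⁻¹' {b} : Set M) × B ↦ (q z.1).1) z :=
      contDiff_fst.contMDiff.contMDiffAt.comp z <|
        ContMDiffAt.comp z (hq.contMDiffOn.contMDiffAt (q.open_source.mem_nhds hz1)) h1
    have h3 : ContMDiffAt ((𝓡 k).prod (𝓡 n)) (𝓡 n) ∞
        (fun z : (π ⁻¹' {b} : Set M) × B ↦ ψ z.2) z :=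
      ContMDiffAt.comp z (hψs.contMDiffAt (ψ.open_source.mem_nhds hz2)) contMDiffAt_snd
    exact h2.prodMk_space (h3.sub contMDiffAt_const)
  have hte : ∀ᶠ z in 𝓝 (x, b), t z ∈ e.target := (ht (x, b) hx hbψ).continuousAt.eventually
    (e.open_target.mem_nhds (by rw [htx]; exact e.map_source hxe))
  have hz1 : ∀ᶠ z : (π ⁻¹' {b} : Set M) × B in 𝓝 (x, b), (z.1 : M) ∈ q.source :=
    (continuous_subtype_val.comp continuous_fst).continuousAt.eventually
      (q.open_source.mem_nhds hx)
  have hz2 : ∀ᶠ z : (π ⁻¹' {b} : Set M) × B in 𝓝 (x, b), z.2 ∈ ψ.source :=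
    continuous_snd.continuousAt.eventually (ψ.open_source.mem_nhds hbψ)
  let g : (π ⁻¹' {b} : Set M) × B → M := fun z ↦ q.symm (e.symm (t z))
  have hgx : g (x, b) = x := by simp only [g, htx, e.left_inv hxe, q.left_inv hx]
  have hg : ∀ᶠ z in 𝓝 (x, b), ContMDiffAt ((𝓡 k).prod (𝓡 n)) (𝓡 m) ∞ g z := by
    filter_upwards [hte, hz1, hz2] with z hz hz1 hz2
    refine ContMDiffAt.comp z (hq.contMDiffOn_symm.contMDiffAt
      (q.open_target.mem_nhds (heO (e.map_target hz)).1)) ?_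
    exact ContMDiffAt.comp z
      (hes.contDiffAt (e.open_target.mem_nhds hz)).contMDiffAt (ht z hz1 hz2)
  have hgt : Tendsto g (𝓝 (x, b)) (𝓝 (x : M)) := by
    simpa [hgx] using hg.self_of_nhds.continuousAt.tendsto
  have hHt : Tendsto H (𝓝 (x : M)) (𝓝 (x : M)) := by
    simpa [hHx] using hH.continuous.tendsto (x : M)
  refine ⟨g, hgx, ?_, ?_⟩
  · filter_upwards [hg, hte, hz1, hz2, hgt.eventually hHS,
      hgt.eventually (hHt.eventually (q.open_source.mem_nhds hx))] with z hzg hz hz1 hz2 hzS hzq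
    refine ⟨hzg, ?_⟩
    have hw := e.map_target hz
    have hgq : q (g z) = e.symm (t z) := q.right_inv (heO hw).1
    have hgs : g z ∈ q.source := q.map_target (heO hw).1
    have h1 : Θ (q (g z)) = t z := by rw [hgq, ← heΘ, e.right_inv hz]
    rw [hΘq _ hgs hzq hzS] at h1
    have h2 := congrArg Prod.fst h1
    have h3 := congrArg Prod.snd h1
    simp only [t] at h2 h3
    constructor
    · refine q.injOn hzq hz1 (Prod.ext h2 ?_)
      rw [(hq.snd_eq_zero_iff hzq).1 hzS, (hq.snd_eq_zero_iff hz1).1 z.1.2]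
    · exact ψ.injOn (hq.mem_source _ hgs) hz2 (sub_left_injective h3)
  · filter_upwards [q.open_source.mem_nhds hx, hHt.eventually (q.open_source.mem_nhds hx),
      (q.continuousAt hx).eventually (e.open_source.mem_nhds hxe)] with y hy hy' hye hyS
    have h1 : t (⟨H y, hyS⟩, π y) = e (q y) := by rw [heΘ, hΘq y hy hy' hyS]
    simp only [g, h1, e.left_inv hye, q.left_inv hy]

/-! ### From the retraction to the trivialization -/

open Classical in
/-- A smooth retraction of a neighbourhood of a nonempty compact fibre onto the fibre, which
together with `π` has smooth local inverses along the fibre, gives a local trivialization. -/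
theorem exists_diffeomorph_of_retraction [IsManifold (𝓡 m) ∞ M]
    [IsManifold (𝓡 n) ∞ B] [T2Space M] [T2Space B] {k : ℕ} {N : Set M} {π : M → B}
    (hπ_proper : IsProperMap π) (hπ : ContMDiff (𝓡 m) (𝓡 n) ∞ π) {b : B}
    [ChartedSpace (EuclideanSpace ℝ (Fin k)) (π ⁻¹' {b})]
    (hS : IsEmbeddedSubmanifold (m := m) (k := k) (π ⁻¹' {b})) (x₀ : π ⁻¹' {b})
    {H : M → M} (hH : ContMDiff (𝓡 m) (𝓡 m) ∞ H) (hHid : ∀ y ∈ π ⁻¹' {b}, H y = y)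
    (hHN : ∀ y, H y ∈ N ↔ y ∈ N) (hHS : ∀ x ∈ π ⁻¹' {b}, ∀ᶠ y in 𝓝 x, H y ∈ π ⁻¹' {b})
    (hloc : ∀ x : π ⁻¹' {b}, ∃ g : (π ⁻¹' {b} : Set M) × B → M, g (x, b) = x ∧
      (∀ᶠ z in 𝓝 (x, b), ContMDiffAt ((𝓡 k).prod (𝓡 n)) (𝓡 m) ∞ g z ∧
        H (g z) = z.1 ∧ π (g z) = z.2) ∧
      ∀ᶠ y in 𝓝 (x : M), ∀ hy : H y ∈ π ⁻¹' {b}, g (⟨H y, hy⟩, π y) = y) :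
    ∃ U : Opens B, b ∈ U ∧
      ∃ Ψ : Diffeomorph (𝓡 m) ((𝓡 k).prod (𝓡 n))
          (Opens.comap ⟨π, hπ_proper.continuous⟩ U) ((π ⁻¹' {b} : Set M) × U) ∞,
        (∀ x, ((Ψ x).2 : B) = π x) ∧
        Ψ '' {x | (x : M) ∈ N} = {y : (π ⁻¹' {b} : Set M) | (y : M) ∈ N} ×ˢ univ := by
  have hman := hS.isManifold
  have hcomp : IsCompact (π ⁻¹' {b}) := hπ_proper.isCompact_preimage isCompact_singleton
  have : CompactSpace (π ⁻¹' {b}) := isCompact_iff_compactSpace.1 hcomp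
  let ρ : M → π ⁻¹' {b} := fun y ↦ if h : H y ∈ π ⁻¹' {b} then ⟨H y, h⟩ else x₀
  have hρ : ∀ y, H y ∈ π ⁻¹' {b} → (ρ y : M) = H y := fun y hy ↦ by simp only [ρ, dif_pos hy]
  let V := interior {y | H y ∈ π ⁻¹' {b}}
  have hV : ∀ y ∈ V, H y ∈ π ⁻¹' {b} := fun y hy ↦ interior_subset (s := {y | H y ∈ π ⁻¹' {b}}) hy
  have hSV : π ⁻¹' {b} ⊆ V := fun x hx ↦ mem_interior_iff_mem_nhds.2 (hHS x hx)
  have hρs : ∀ y ∈ V, ContMDiffAt (𝓡 m) (𝓡 k) ∞ ρ y := by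
    intro y hy
    have h1 : Subtype.val ∘ ρ =ᶠ[𝓝 y] H :=
      eventually_of_mem (isOpen_interior.mem_nhds hy) fun z hz ↦ hρ z (hV z hz)
    have h2 : ContMDiffAt (𝓡 m) (𝓡 m) ∞ (Subtype.val ∘ ρ) y :=
      hH.contMDiffAt.congr_of_eventuallyEq h1
    -- Smoothness into the fibre is tested after the inclusion, which is an immersion.
    rw [ContMDiffAt.iff_comp_isImmersionAt (hS.isSmoothEmbedding.isImmersion.isImmersionAt (ρ y))]
    exact ⟨IsEmbedding.subtypeVal.continuousAt_iff.2 h2.continuousAt, h2⟩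
  let f : M → (π ⁻¹' {b} : Set M) × B := fun y ↦ (ρ y, π y)
  have hinj : InjOn f (π ⁻¹' {b}) := by
    intro y hy y' hy' h
    have h1 := congrArg (fun z : (π ⁻¹' {b} : Set M) × B ↦ (z.1 : M)) h
    have e1 : (ρ y : M) = y := by rw [hρ y (hV y (hSV hy)), hHid y hy]
    have e2 : (ρ y' : M) = y' := by rw [hρ y' (hV y' (hSV hy')), hHid y' hy']
    exact e1.symm.trans (h1.trans e2)
  -- A map injective on a compact set and locally injective at each of its points is injective on a
  -- neighbourhood; the left inverses from `hloc` give local injectivity.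
  obtain ⟨t, ht, hSt, htinj⟩ := hinj.exists_isOpen_superset hcomp
    (fun x hx ↦ (hρs x (hSV hx)).continuousAt.prodMk hπ.continuous.continuousAt) (fun x hx ↦ by
      obtain ⟨g, -, -, hg⟩ := hloc ⟨x, hx⟩
      refine ⟨_, inter_mem (hHS x hx) hg, ?_⟩
      rintro y ⟨hy, hgy⟩ y' ⟨hy', hgy'⟩ h
      have h1 : (⟨H y, hy⟩ : π ⁻¹' {b}) = ⟨H y', hy'⟩ := Subtype.ext <| by
        exact ((hρ y hy).symm.trans
          (congrArg (fun z : (π ⁻¹' {b} : Set M) × B ↦ (z.1 : M)) h)).trans (hρ y' hy')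
      have h2 : π y = π y' := congrArg Prod.snd h
      rw [← hgy hy, ← hgy' hy', h1, h2])
  let W := V ∩ t
  have hW : IsOpen W := isOpen_interior.inter ht
  have hSW : π ⁻¹' {b} ⊆ W := fun x hx ↦ ⟨hSV hx, hSt hx⟩
  -- Properness: fibres close to `M_b` lie in any given neighbourhood of it.
  have hU1 : ∀ᶠ β in 𝓝 b, ∀ y ∈ π ⁻¹' {β}, y ∈ W :=
    hπ_proper.isClosedMap.eventually_nhds_fiber b fun x hx ↦ hW.mem_nhds (hSW hx)
  -- `P β s` provides a smooth local right inverse near `(s, β)` with values in `W`. Compactness of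
  -- the fibre makes it hold for all `s` at once when `β` is near `b`.
  let P : B → (π ⁻¹' {b} : Set M) → Prop := fun β s ↦ ∃ g : (π ⁻¹' {b} : Set M) × B → M,
    ContMDiffAt ((𝓡 k).prod (𝓡 n)) (𝓡 m) ∞ g (s, β) ∧
      ∀ᶠ z in 𝓝 (s, β), g z ∈ W ∧ H (g z) = z.1 ∧ π (g z) = z.2
  have hU2 : ∀ᶠ β in 𝓝 b, ∀ s ∈ (univ : Set (π ⁻¹' {b} : Set M)), P β s := by
    refine isCompact_univ.eventually_forall_of_forall_eventually fun s _ ↦ ?_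
    obtain ⟨g, hgs, hg, -⟩ := hloc s
    have h1 : ∀ᶠ z in 𝓝 (s, b), g z ∈ W := hg.self_of_nhds.1.continuousAt.eventually
      (hW.mem_nhds (by rw [hgs]; exact hSW s.2))
    have h2 : ∀ᶠ z in 𝓝 (s, b), P z.2 z.1 := by
      filter_upwards [hg, (h1.and hg).eventually_nhds] with z hz hz'
      exact ⟨g, hz.1, hz'.mono fun w hw ↦ ⟨hw.1, hw.2.2⟩⟩
    exact (continuous_swap.tendsto (b, s)).eventually h2
  obtain ⟨U₀, hU₀, hU₀o, hbU₀⟩ := eventually_nhds_iff.1 (hU1.and hU2)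
  let U : Opens B := ⟨U₀, hU₀o⟩
  have hUW : ∀ y, π y ∈ U₀ → y ∈ W := fun y hy ↦ (hU₀ _ hy).1 y rfl
  let F : Opens.comap ⟨π, hπ_proper.continuous⟩ U → (π ⁻¹' {b} : Set M) × U :=
    fun y ↦ (ρ y, ⟨π y, y.2⟩)
  have hF : Function.Bijective F := by
    constructor
    · intro y y' h
      refine Subtype.ext (htinj (hUW y y.2).2 (hUW y' y'.2).2 (Prod.ext ?_ ?_))
      · exact congrArg (fun z : (π ⁻¹' {b} : Set M) × U ↦ z.1) h
      · exact congrArg (fun z : (π ⁻¹' {b} : Set M) × U ↦ (z.2 : B)) h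
    · rintro ⟨s, β, hβ⟩
      obtain ⟨g, -, hg⟩ := (hU₀ β hβ).2 s (mem_univ s)
      obtain ⟨h1, h2, h3⟩ := hg.self_of_nhds
      have h3' : π (g (s, β)) = β := h3
      refine ⟨⟨g (s, β), show π (g (s, β)) ∈ U₀ by rwa [h3']⟩, Prod.ext (Subtype.ext ?_)
        (Subtype.ext h3')⟩
      exact (hρ _ (hV _ h1.1)).trans h2
  let Φ := Equiv.ofBijective F hF
  have hFs : ContMDiff (𝓡 m) ((𝓡 k).prod (𝓡 n)) ∞ F := by
    refine ContMDiff.prodMk (fun y ↦ ?_) ?_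
    · exact (hρs y (hUW y y.2).1).comp y contMDiff_subtype_val.contMDiffAt
    · rw [ContMDiff.iff_comp_isImmersion (Manifold.IsImmersion.of_opens U)]
      exact ⟨Continuous.subtype_mk (hπ.continuous.comp continuous_subtype_val) _,
        hπ.comp contMDiff_subtype_val⟩
  have hΦs : ContMDiff ((𝓡 k).prod (𝓡 n)) (𝓡 m) ∞ Φ.symm := by
    have key : ContMDiff ((𝓡 k).prod (𝓡 n)) (𝓡 m) ∞ fun z ↦ (Φ.symm z : M) := by
      rintro ⟨s, β⟩
      obtain ⟨g, hg, hgW⟩ := (hU₀ β β.2).2 s (mem_univ s)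
      have hi : ContMDiff ((𝓡 k).prod (𝓡 n)) ((𝓡 k).prod (𝓡 n)) ∞
          (fun z : (π ⁻¹' {b} : Set M) × U ↦ (z.1, (z.2 : B))) :=
        contMDiff_fst.prodMk (contMDiff_subtype_val.comp contMDiff_snd)
      refine (ContMDiffAt.comp (s, β) hg hi.contMDiffAt).congr_of_eventuallyEq ?_
      filter_upwards [hi.continuous.continuousAt.eventually hgW] with z hz
      obtain ⟨h1, h2, h3⟩ := hz
      have h4 : F (Φ.symm z) = z := Φ.apply_symm_apply z
      -- Injectivity on `W` identifies the global inverse with the smooth local one.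
      refine htinj (hUW _ (Φ.symm z).2).2 h1.2 (Prod.ext (Subtype.ext ?_) ?_)
      · refine Eq.trans ?_ (((hρ _ (hV _ h1.1)).trans h2).symm)
        exact congrArg (fun z : (π ⁻¹' {b} : Set M) × U ↦ (z.1 : M)) h4
      · exact (congrArg (fun z : (π ⁻¹' {b} : Set M) × U ↦ (z.2 : B)) h4).trans h3.symm
    rw [ContMDiff.iff_comp_isImmersion (Manifold.IsImmersion.of_opens _)]
    exact ⟨continuous_induced_rng.2 key.continuous, key⟩
  refine ⟨U, hbU₀, ⟨Φ, hFs, hΦs⟩, fun x ↦ rfl, ?_⟩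
  have hmem : ∀ y : Opens.comap ⟨π, hπ_proper.continuous⟩ U, ((F y).1 : M) ∈ N ↔ (y : M) ∈ N :=
    fun y ↦ by rw [show ((F y).1 : M) = H y from hρ _ (hV _ (hUW y y.2).1), hHN]
  ext z
  constructor
  · rintro ⟨y, hy, rfl⟩
    exact ⟨(hmem y).2 hy, mem_univ _⟩
  · rintro ⟨hz, -⟩
    obtain ⟨y, rfl⟩ := hF.2 z
    exact ⟨y, (hmem y).1 hz, rfl⟩

end Ehresmann

/-! ### The relative Ehresmann theorem -/

theorem mainTheorem8 {m n p : ℕ}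
    {M : Type*} [TopologicalSpace M] [T2Space M] [SecondCountableTopology M]
    [ChartedSpace (EuclideanSpace ℝ (Fin m)) M] [IsManifold (𝓡 m) ∞ M]
    {B : Type*} [TopologicalSpace B] [T2Space B] [SecondCountableTopology B]
    [ChartedSpace (EuclideanSpace ℝ (Fin n)) B] [IsManifold (𝓡 n) ∞ B]
    (N : Set M) [ChartedSpace (EuclideanSpace ℝ (Fin p)) N]
    (hN : IsEmbeddedSubmanifold (m := m) (k := p) N) (hN_closed : IsClosed N)
    (π : M → B) (hπ_proper : IsProperMap π)
    (hπ : Manifold.IsSubmersion (𝓡 m) (𝓡 n) ∞ π)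
    (hπN : Manifold.IsSubmersion (𝓡 p) (𝓡 n) ∞ (fun x : N => π x))
    (b : B) :
    ∃ (k : ℕ) (_ : ChartedSpace (EuclideanSpace ℝ (Fin k)) (π ⁻¹' {b})),
      IsEmbeddedSubmanifold (m := m) (k := k) (π ⁻¹' {b}) ∧
      ∃ U : Opens B, b ∈ U ∧
        ∃ Ψ : Diffeomorph (𝓡 m) ((𝓡 k).prod (𝓡 n))
            (Opens.comap ⟨π, hπ_proper.continuous⟩ U) ((π ⁻¹' {b} : Set M) × U) ∞,
          (∀ x, ((Ψ x).2 : B) = π x) ∧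
          Ψ '' {x | (x : M) ∈ N} = {y : (π ⁻¹' {b} : Set M) | (y : M) ∈ N} ×ˢ univ := by
  rcases (π ⁻¹' {b}).eq_empty_or_nonempty with hb | ⟨x₀, hx₀⟩
  · have hbU : b ∈ (range π)ᶜ := by
      rintro ⟨x, hx⟩
      exact hb.le (show x ∈ π ⁻¹' {b} from hx)
    -- A proper map has closed image, so over this `U` both sides are empty; the dimension `k` is
    -- then immaterial.
    let U : Opens B := ⟨(range π)ᶜ, hπ_proper.isClosedMap.isClosed_range.isOpen_compl⟩
    have hS : IsEmpty (π ⁻¹' {b}) := isEmpty_coe_sort.2 hb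
    have hX : IsEmpty (Opens.comap ⟨π, hπ_proper.continuous⟩ U) := ⟨fun x ↦ x.2 ⟨x, rfl⟩⟩
    let _ : ChartedSpace (EuclideanSpace ℝ (Fin (m - n))) (π ⁻¹' {b}) := ChartedSpace.empty _ _
    refine ⟨m - n, inferInstance, ⟨inferInstance, ⟨⟨EuclideanSpace ℝ (Fin m), inferInstance,
      inferInstance, fun x ↦ isEmptyElim x⟩, IsEmbedding.subtypeVal⟩⟩, U, hbU,
      ⟨Equiv.equivOfIsEmpty _ _, fun x ↦ isEmptyElim x, fun x ↦ isEmptyElim x.1⟩,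
      fun x ↦ isEmptyElim x, ?_⟩
    ext z
    exact isEmptyElim z.1
  · have hchart : ∀ x ∈ π ⁻¹' {b}, ∃ q : OpenPartialHomeomorph M
        (EuclideanSpace ℝ (Fin (m - n)) × EuclideanSpace ℝ (Fin n)),
        x ∈ q.source ∧ IsAdaptedChart (m := m) N π b q := by
      rintro x rfl
      obtain ⟨q, hx, hq, -⟩ := exists_isAdaptedChart hN hN_closed hπ hπN x
      exact ⟨q, hx, hq⟩
    -- `T` expresses only that `(m - n) + n = m`, which needs a point of `M`; here the fibre
    -- provides `x₀`.
    obtain ⟨-, -, -, ⟨T⟩⟩ := exists_isAdaptedChart hN hN_closed hπ hπN x₀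
    obtain ⟨c, hS⟩ := exists_isEmbeddedSubmanifold_of_slice T (π ⁻¹' {b}) fun x hx ↦ by
      obtain ⟨q, hxq, hq⟩ := hchart x hx
      exact ⟨q, hxq, hq.toIsSmoothProductChart, fun y hy ↦ hq.snd_eq_zero_iff hy⟩
    obtain ⟨H, hH, hHid, hHN, hHS⟩ := exists_retraction_fibre
      (hπ_proper.isCompact_preimage isCompact_singleton) hchart
    refine ⟨m - n, c, hS, exists_diffeomorph_of_retraction hπ_proper hπ.contMDiff hS ⟨x₀, hx₀⟩
      hH hHid hHN hHS fun x ↦ ?_⟩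
    obtain ⟨q, hxq, hq⟩ := hchart x x.2
    exact hq.exists_local_inverse hS.isSmoothEmbedding.contMDiff hxq hH hHid (hHS x x.2)
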